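/- Let $\mathit{Act}$ be a set (of atomic actions) and $V$ a set of variables containing three distinct variables $x_1,x_2,y$. The TSS (transition system specification) $\mathrm{BPA}_{\bf 0}^{;}$ of basic process algebra with sequencing has as signature a constant $v$ for each $v\in \mathit{Act}$, a constant ${\bf 0}$, and binary symbols $+$ and $;$. Its action labels are the elements of $\mathit{Act}$, and its rules are, for all $v,w\in \mathit{Act}$, $$v\xrightarrow{v}{\bf 0},\qquad \frac{x_1\xrightarrow{v}y}{x_1+x_2\xrightarrow{v}y},\qquad \frac{x_2\xrightarrow{v}y}{x_1+x_2\xrightarrow{v}y},\qquad \frac{x_1\xrightarrow{v}y}{x_1;x_2\xrightarrow{v}y;x_2},\qquad \frac{\{x_1\not\xrightarrow{u}\ \mid u\in \mathit{Act}\}\quad x_2\xrightarrow{w}y}{x_1;x_2\xrightarrow{w}y}.$$ **Semantics.** A positive literal $t\xrightarrow{a}t'$ and the negative literal $t\not\xrightarrow{a}$ deny each other. A rule $\frac{K}{\alpha}$ is provable from a TSS $P$ if $\alpha$ is the root of a well-founded tree of literals in which each node is either a hypothesis from $K$ or is obtained from the nodes directly above it by a substitution instance of a rule of $P$. A closed literal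 is $ws$-provable if it is the root of a well-founded tree of closed literals in which each node $\beta$, with $K$ the set of labels directly above it, satisfies one of the following: $\frac{K}{\beta}$ is a closed substitution instance of a rule of $P$; or $\beta$ is negative and, for every set $N$ of negative closed literals such that $\frac{N}{\gamma}$ is provable from $P$ for some closed $\gamma$ denying $\beta$, a literal in $K$ denies one in $N$. For closed terms $p$, put: $p\models\top$ always; $p\models a\varphi$ iff $p\xrightarrow{a}q$ is $ws$-provable for some closed $q\models\varphi$; $p\models\widetilde a$ iff $p\not\xrightarrow{a}$ is $ws$-provable; $p\models\bigwedge_{i\in I}\varphi_i$ iff $p\models\varphi_i$ for all $i\in I$. For $N\in\{RS,RT,R,F\}$ (ready simulation, ready trace, readiness, failure) the $N$-preorder induced by $P$ is: $p\sqsubseteq_N q$ iff every $N$-observation satisfied by $p$ is satisfied by $q$. Here the $N$-observations are given by the following grammars, with arbitrary index sets: - $RS$: $\varphi::=\top\mid a\varphi\mid\widetilde a\mid\bigwedge_{i\in I}\varphi_i$; - $RT$: $\varphi::=\top\mid a\varphi\mid\bigwedge_{i\in I}\widetilde{a_i}\wedge\bigwedge_{j\in J}b_j\top\wedge\varphi$;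 - $R$: $\varphi::=\top\mid a\varphi\mid\bigwedge_{i\in I}\widetilde{a_i}\wedge\bigwedge_{j\in J}b_j\top$; - $F$: $\varphi::=\top\mid a\varphi\mid\bigwedge_{i\in I}\widetilde{a_i}$. A preorder $\sqsubseteq$ on closed terms is a precongruence if, for every function symbol $f$, $p_i\sqsubseteq q_i$ for all $i$ implies $f(p_1,\dots,p_n)\sqsubseteq f(q_1,\dots,q_n)$. **Readiness format.** A TSS is in readiness format if all its rules have positive conclusions and there is a predicate $\Lambda$, declaring certain arguments of function symbols liquid, such that each rule $\frac{H}{s\xrightarrow{a}u}$ satisfies the following. 1. The right-hand sides of positive premises are distinct variables not occurring in the source $s$, and $s$ is a variable or a function symbol applied to distinct variables. 2. No right-hand side of a positive premise occurs in the left-hand side of a premise. 3. Each floating variable has at most one propagated occurrence, and such an occurrence is at a liquid position. 4. No floating variable has both propagated and polled occurrences. Here a position in a term is liquid if every argument on the path to it is liquid. A variable is floating if it is the right-hand side of a positive premise or occurs exactly once in $s$, at a liquid position. An occurrence is propagated if it is in $u$, or in the left-hand side of a positive premise whose right-hand side occurs in $u$; it is polled if it is in the left-hand side of any other premise. **Statement.**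 The TSS $\mathrm{BPA}_{\bf 0}^{;}$ is in readiness format, and the ready simulation, ready trace and readiness preorders induced by it are precongruences. If $\mathit{Act}$ has at least two elements, the failure preorder induced by it is not a precongruence. -/

import Mathlib

universe u

namespace SOS

/-! ### Signatures, terms, literals, transition rules -/

/-- A signature: function symbols with arities. -/
structure Signature where
  symbols : Type u
  arity : symbols → ℕ

/-- Terms over the signature `S` with variables from `V`. -/
inductive Term (S : Signature.{u}) (V : Type u) : Type u
  | var (x : V) : Term S V
  | app (f : S.symbols) (ts : Fin (S.arity f) → Term S V) : Term S V

namespace Term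

variable {S : Signature.{u}} {V : Type u}

/-- The set of variables that occur in a term. -/
def vars : Term S V → Set V
  | var x => {x}
  | app _ ts => ⋃ i, (ts i).vars

/-- Replace every variable `x` by `σ x`. -/
def subst (σ : V → Term S V) : Term S V → Term S V
  | var x => σ x
  | app f ts => app f (fun i => (ts i).subst σ)

/-- `t.OccursAt x π`: the variable `x` has an occurrence in `t` at position `π`, a list of
argument numbers leading from the root of `t` to the occurrence. -/
inductive OccursAt (x : V) : Term S V → List ℕ → Prop
  | var : OccursAt x (var x) []
  | app (f : S.symbols) (ts : Fin (S.arity f) → Term S V) (i : Fin (S.arity f)) (π : List ℕ) :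
      OccursAt x (ts i) π → OccursAt x (app f ts) (i.val :: π)

/-- `t.LiquidAt Λ x π`: the variable `x` has an occurrence in `t` at position `π`, and this
is a `Λ`-liquid position: all arguments on the path to it are liquid according to `Λ`. -/
inductive LiquidAt (Λ : (f : S.symbols) → Fin (S.arity f) → Prop) (x : V) :
    Term S V → List ℕ → Prop
  | var : LiquidAt Λ x (var x) []
  | app (f : S.symbols) (ts : Fin (S.arity f) → Term S V) (i : Fin (S.arity f)) (π : List ℕ) :
      Λ f i → LiquidAt Λ x (ts i) π → LiquidAt Λ x (app f ts) (i.val :: π)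

/-- A term is closed if no variable occurs in it. -/
def Closed (t : Term S V) : Prop := t.vars = ∅

end Term

/-- The set `T(S)` of closed terms. -/
def ClosedTerm (S : Signature.{u}) (V : Type u) : Type u := {t : Term S V // t.Closed}

/-- The closed term `f(p₁, …, pₙ)`. -/
def ClosedTerm.app {S : Signature.{u}} {V : Type u} (f : S.symbols)
    (p : Fin (S.arity f) → ClosedTerm S V) : ClosedTerm S V :=
  ⟨Term.app f (fun i => (p i).1), Set.iUnion_eq_empty.2 (fun i => (p i).2)⟩

/-- Literals: `pos t a t'` is the transition `t --a--> t'`; `neg t a` is its negated form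
`t -a↛`. -/
inductive Literal (S : Signature.{u}) (V A : Type u) : Type u
  | pos (t : Term S V) (a : A) (t' : Term S V) : Literal S V A
  | neg (t : Term S V) (a : A) : Literal S V A

namespace Literal

variable {S : Signature.{u}} {V A : Type u}

/-- The left-hand side of a literal. -/
def lhs : Literal S V A → Term S V
  | pos t _ _ => t
  | neg t _ => t

/-- Apply a substitution to a literal. -/
def subst (σ : V → Term S V) : Literal S V A → Literal S V A
  | pos t a t' => pos (t.subst σ) a (t'.subst σ)
  | neg t a => neg (t.subst σ) a

/-- A literal is closed if the terms in it are closed. -/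
def Closed : Literal S V A → Prop
  | pos t _ t' => t.Closed ∧ t'.Closed
  | neg t _ => t.Closed

/-- The literal is negative. -/
def IsNegative (α : Literal S V A) : Prop := ∃ t a, α = neg t a

/-- `t --a--> t'` and `t -a↛` deny each other. -/
def Denies (α β : Literal S V A) : Prop :=
  ∃ t a t', (α = pos t a t' ∧ β = neg t a) ∨ (α = neg t a ∧ β = pos t a t')

end Literal

/-- A transition rule: a set of premises and a conclusion. -/
structure Rule (S : Signature.{u}) (V A : Type u) : Type u where
  premises : Set (Literal S V A)
  conclusion : Literal S V A

/-- A transition system specification over the signature `S`: a collection of rules. -/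
abbrev TSS (S : Signature.{u}) (V A : Type u) : Type u := Set (Rule S V A)

/-! ### Provability and well-supported provability -/

section Provability

variable {S : Signature.{u}} {V A : Type u}

/-- `Provable P K α`: the rule `K / α` is provable from `P`, i.e. there is a well-founded
proof tree with root `α` in which every node is either a hypothesis, taken from `K`, or the
conclusion of a substitution instance of a rule of `P` whose premises are the labels of the
nodes directly above it. -/
inductive Provable (P : TSS S V A) (K : Set (Literal S V A)) : Literal S V A → Prop
  | hyp (α : Literal S V A) : α ∈ K → Provable P K α
  | rule (r : Rule S V A) (σ : V → Term S V) : r ∈ P →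
      (∀ β ∈ r.premises, Provable P K (β.subst σ)) → Provable P K (r.conclusion.subst σ)

/-- `WSProvable P α`: the closed literal `α` has a well-supported proof from `P`. -/
inductive WSProvable (P : TSS S V A) : Literal S V A → Prop
  | rule (r : Rule S V A) (σ : V → Term S V) : r ∈ P → (∀ x, (σ x).Closed) →
      (∀ β ∈ r.premises, WSProvable P (β.subst σ)) → WSProvable P (r.conclusion.subst σ)
  | naf (t : Term S V) (a : A) (K : Set (Literal S V A)) : t.Closed →
      (∀ β ∈ K, β.Closed) → (∀ β ∈ K, WSProvable P β) →
      (∀ (N : Set (Literal S V A)) (γ : Literal S V A),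
        (∀ ν ∈ N, ν.Closed ∧ ν.IsNegative) → γ.Closed → γ.Denies (.neg t a) →
        Provable P N γ → ∃ β ∈ K, ∃ ν ∈ N, β.Denies ν) →
      WSProvable P (.neg t a)

end Provability

/-! ### Observations and the preorders induced by a TSS -/

/-- The (ready simulation) observations over the action set `A`, generated by `⊤`, `aφ`,
the refusal `ã` of an action, and arbitrary conjunctions. -/
inductive Obs (A : Type u) : Type (u + 1)
  | top : Obs A
  | act (a : A) (φ : Obs A) : Obs A
  | refuse (a : A) : Obs A
  | conj (I : Type u) (φ : I → Obs A) : Obs A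

/-- Binary conjunction, as a conjunction over a two-element index set. -/
def Obs.and {A : Type u} (φ ψ : Obs A) : Obs A :=
  .conj (ULift.{u} Bool) (fun i => if i.down then φ else ψ)

/-- Failure observations: `φ ::= ⊤ | aφ | ⋀ᵢ ãᵢ`. -/
inductive IsFailureObs {A : Type u} : Obs A → Prop
  | top : IsFailureObs .top
  | act (a : A) (φ : Obs A) : IsFailureObs φ → IsFailureObs (.act a φ)
  | fail (I : Type u) (a : I → A) : IsFailureObs (.conj I (fun i => .refuse (a i)))

/-- Readiness observations: `φ ::= ⊤ | aφ | ⋀ᵢ ãᵢ ∧ ⋀ⱼ bⱼ⊤`. -/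
inductive IsReadinessObs {A : Type u} : Obs A → Prop
  | top : IsReadinessObs .top
  | act (a : A) (φ : Obs A) : IsReadinessObs φ → IsReadinessObs (.act a φ)
  | ready (I J : Type u) (a : I → A) (b : J → A) :
      IsReadinessObs
        (.and (.conj I (fun i => .refuse (a i))) (.conj J (fun j => .act (b j) .top)))

/-- Ready trace observations: `φ ::= ⊤ | aφ | ⋀ᵢ ãᵢ ∧ ⋀ⱼ bⱼ⊤ ∧ φ`. -/
inductive IsReadyTraceObs {A : Type u} : Obs A → Prop
  | top : IsReadyTraceObs .top
  | act (a : A) (φ : Obs A) : IsReadyTraceObs φ → IsReadyTraceObs (.act a φ)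
  | ready (I J : Type u) (a : I → A) (b : J → A) (φ : Obs A) : IsReadyTraceObs φ →
      IsReadyTraceObs
        (.and (.and (.conj I (fun i => .refuse (a i))) (.conj J (fun j => .act (b j) .top))) φ)

section Preorders

variable {S : Signature.{u}} {V A : Type u}

/-- `Sat P φ p`: the closed term `p` satisfies the observation `φ` with respect to `P`. -/
def Sat (P : TSS S V A) : Obs A → ClosedTerm S V → Prop
  | .top, _ => True
  | .act a φ, p => ∃ q : ClosedTerm S V, WSProvable P (.pos p.1 a q.1) ∧ Sat P φ q
  | .refuse a, p => WSProvable P (.neg p.1 a)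
  | .conj _ φ, p => ∀ i, Sat P (φ i) p

/-- The ready simulation preorder induced by `P`. -/
def ReadySimulationPreorder (P : TSS S V A) (p q : ClosedTerm S V) : Prop :=
  ∀ φ : Obs A, Sat P φ p → Sat P φ q

/-- The ready trace preorder induced by `P`. -/
def ReadyTracePreorder (P : TSS S V A) (p q : ClosedTerm S V) : Prop :=
  ∀ φ : Obs A, IsReadyTraceObs φ → Sat P φ p → Sat P φ q

/-- The readiness preorder induced by `P`. -/
def ReadinessPreorder (P : TSS S V A) (p q : ClosedTerm S V) : Prop :=
  ∀ φ : Obs A, IsReadinessObs φ → Sat P φ p → Sat P φ q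

/-- The failure preorder induced by `P`. -/
def FailurePreorder (P : TSS S V A) (p q : ClosedTerm S V) : Prop :=
  ∀ φ : Obs A, IsFailureObs φ → Sat P φ p → Sat P φ q

/-- A (reflexive and transitive) relation on closed terms is a precongruence if it is
preserved by all function symbols. -/
def IsPrecongruence (rel : ClosedTerm S V → ClosedTerm S V → Prop) : Prop :=
  ∀ (f : S.symbols) (p q : Fin (S.arity f) → ClosedTerm S V),
    (∀ i, rel (p i) (q i)) → rel (ClosedTerm.app f p) (ClosedTerm.app f q)

end Preorders

/-! ### The readiness format -/

namespace Rule

variable {S : Signature.{u}} {V A : Type u}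

/-- The source of a rule: the left-hand side of its conclusion. -/
def source (r : Rule S V A) : Term S V := r.conclusion.lhs

/-- The rule has a positive conclusion with target `u`. -/
def HasTarget (r : Rule S V A) (u : Term S V) : Prop := ∃ s a, r.conclusion = .pos s a u

/-- The rule is standard: its conclusion is positive. -/
def IsStandard (r : Rule S V A) : Prop := ∃ u, r.HasTarget u

/-- An ntytt rule: the right-hand sides of positive premises are distinct variables that do
not occur in the source. -/
def IsNtytt (r : Rule S V A) : Prop :=
  (∀ t a t', Literal.pos t a t' ∈ r.premises → ∃ y, t' = .var y ∧ y ∉ r.source.vars) ∧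
  (∀ t₁ a₁ t₂ a₂ y, Literal.pos t₁ a₁ (.var y) ∈ r.premises →
    Literal.pos t₂ a₂ (.var y) ∈ r.premises → t₁ = t₂ ∧ a₁ = a₂)

/-- An ntyxt rule: an ntytt rule whose source is a variable. -/
def IsNtyxt (r : Rule S V A) : Prop := r.IsNtytt ∧ ∃ x, r.source = .var x

/-- An ntyft rule: an ntytt rule whose source is a function symbol applied to distinct
variables. -/
def IsNtyft (r : Rule S V A) : Prop :=
  r.IsNtytt ∧ ∃ (f : S.symbols) (x : Fin (S.arity f) → V), Function.Injective x ∧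
    r.source = .app f (fun i => .var (x i))

/-- The variables in right-hand sides of positive premises do not occur in left-hand sides
of premises. -/
def NoLookahead (r : Rule S V A) : Prop :=
  ∀ t a t', Literal.pos t a t' ∈ r.premises → ∀ y ∈ t'.vars, ∀ β ∈ r.premises, y ∉ β.lhs.vars

/-- `β` is a positive literal whose right-hand side is a variable that occurs in the target
of `r`. -/
def RhsInTarget (r : Rule S V A) (β : Literal S V A) : Prop :=
  ∃ t a y u, β = .pos t a (.var y) ∧ r.HasTarget u ∧ y ∈ u.vars

/-- `r.PropagatedAt x l t π`: the variable `x` has a propagated occurrence in `r`, at position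
`π` of the term `t`. The place `l` of the term `t` in the rule is `none` if `t` is the target,
and `some β` if `t` is the left-hand side of the premise `β`. -/
inductive PropagatedAt (r : Rule S V A) (x : V) :
    Option (Literal S V A) → Term S V → List ℕ → Prop
  | target (u : Term S V) (π : List ℕ) : r.HasTarget u → u.OccursAt x π →
      PropagatedAt r x none u π
  | premise (β : Literal S V A) (π : List ℕ) : β ∈ r.premises → r.RhsInTarget β →
      β.lhs.OccursAt x π → PropagatedAt r x (some β) β.lhs π

/-- The variable `x` has a polled occurrence in `r`: an occurrence in the left-hand side of a
premise that does not have a right-hand side occurring in the target. -/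
def IsPolled (r : Rule S V A) (x : V) : Prop :=
  ∃ β ∈ r.premises, ¬ r.RhsInTarget β ∧ ∃ π, β.lhs.OccursAt x π

/-- The variable `x` is `Λ`-floating in `r`: it is the right-hand side of a positive premise, or
it occurs exactly once in the source, at a `Λ`-liquid position. -/
def IsFloating (Λ : (f : S.symbols) → Fin (S.arity f) → Prop) (r : Rule S V A) (x : V) : Prop :=
  (∃ t a, Literal.pos t a (.var x) ∈ r.premises) ∨
  (∃ π, r.source.LiquidAt Λ x π ∧ ∀ π', r.source.OccursAt x π' → π' = π)

/-- `Λ`-ready trace safety: no lookahead, and each `Λ`-floating variable has at most one propagated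
occurrence, which must be at a `Λ`-liquid position. -/
def ReadyTraceSafe (Λ : (f : S.symbols) → Fin (S.arity f) → Prop) (r : Rule S V A) : Prop :=
  r.NoLookahead ∧
  ∀ x, r.IsFloating Λ x →
    (∀ l t π l' t' π', r.PropagatedAt x l t π → r.PropagatedAt x l' t' π' →
      l = l' ∧ π = π') ∧
    (∀ l t π, r.PropagatedAt x l t π → t.LiquidAt Λ x π)

/-- `Λ`-readiness safety: `Λ`-ready trace safety, and no `Λ`-floating variable has both propagated
and polled occurrences. -/
def ReadinessSafe (Λ : (f : S.symbols) → Fin (S.arity f) → Prop) (r : Rule S V A) : Prop :=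
  r.ReadyTraceSafe Λ ∧
  ∀ x, r.IsFloating Λ x → ¬ ((∃ l t π, r.PropagatedAt x l t π) ∧ r.IsPolled x)

end Rule

/-- A TSS is in readiness format if it is standard, in ntyft/ntyxt format, and its rules are
`Λ`-readiness safe with respect to some predicate `Λ` (the liquid arguments). -/
def InReadinessFormat {S : Signature.{u}} {V A : Type u} (P : TSS S V A) : Prop :=
  (∀ r ∈ P, r.IsStandard) ∧ (∀ r ∈ P, r.IsNtyft ∨ r.IsNtyxt) ∧
  ∃ Λ : (f : S.symbols) → Fin (S.arity f) → Prop, ∀ r ∈ P, r.ReadinessSafe Λ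

/-! ### Basic process algebra with sequencing -/

/-- The function symbols of basic process algebra with sequencing over the set `Act` of atomic
actions: the atomic actions, the constant `0`, alternative composition, sequencing. -/
inductive BPASymbol (Act : Type u) : Type u
  | atom (v : Act) : BPASymbol Act
  | zero : BPASymbol Act
  | alt : BPASymbol Act
  | seq : BPASymbol Act

/-- The signature of basic process algebra with sequencing. -/
abbrev bpaSig (Act : Type u) : Signature.{u} where
  symbols := BPASymbol Act
  arity
    | .atom _ => 0
    | .zero => 0
    | .alt => 2
    | .seq => 2

section BPA

variable {Act V : Type u}

/-- The constant of an atomic action. -/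
def atom (v : Act) : Term (bpaSig Act) V :=
  Term.app (S := bpaSig Act) (BPASymbol.atom v) (Fin.elim0 : Fin 0 → Term (bpaSig Act) V)

/-- The constant `0`. -/
def zero : Term (bpaSig Act) V :=
  Term.app (S := bpaSig Act) BPASymbol.zero (Fin.elim0 : Fin 0 → Term (bpaSig Act) V)

/-- Alternative composition `s + t`. -/
def alt (s t : Term (bpaSig Act) V) : Term (bpaSig Act) V :=
  Term.app (S := bpaSig Act) BPASymbol.alt (![s, t] : Fin 2 → Term (bpaSig Act) V)

/-- Sequencing `s ; t`. -/
def seq (s t : Term (bpaSig Act) V) : Term (bpaSig Act) V :=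
  Term.app (S := bpaSig Act) BPASymbol.seq (![s, t] : Fin 2 → Term (bpaSig Act) V)

/-- The transition rules of basic process algebra with sequencing, written with the variables
`x₁`, `x₂`, `y`; the transition labels are the atomic actions. -/
inductive BPARule (x₁ x₂ y : V) : Rule (bpaSig Act) V Act → Prop
  /-- `v --v--> 0` -/
  | atom (v : Act) : BPARule x₁ x₂ y ⟨∅, .pos (atom v) v zero⟩
  /-- `x₁ --v--> y` implies `x₁ + x₂ --v--> y` -/
  | alt_left (v : Act) : BPARule x₁ x₂ y
      ⟨{.pos (.var x₁) v (.var y)}, .pos (alt (.var x₁) (.var x₂)) v (.var y)⟩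
  /-- `x₂ --v--> y` implies `x₁ + x₂ --v--> y` -/
  | alt_right (v : Act) : BPARule x₁ x₂ y
      ⟨{.pos (.var x₂) v (.var y)}, .pos (alt (.var x₁) (.var x₂)) v (.var y)⟩
  /-- `x₁ --v--> y` implies `x₁ ; x₂ --v--> y ; x₂` -/
  | seq_left (v : Act) : BPARule x₁ x₂ y
      ⟨{.pos (.var x₁) v (.var y)}, .pos (seq (.var x₁) (.var x₂)) v (seq (.var y) (.var x₂))⟩
  /-- `x₁ -v↛` for all `v ∈ Act`, and `x₂ --w--> y`, imply `x₁ ; x₂ --w--> y` -/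
  | seq_right (w : Act) : BPARule x₁ x₂ y
      ⟨insert (.pos (.var x₂) w (.var y)) {α | ∃ v : Act, α = .neg (.var x₁) v},
        .pos (seq (.var x₁) (.var x₂)) w (.var y)⟩

/-- The TSS of basic process algebra with sequencing. -/
def bpaSeq (Act : Type u) {V : Type u} (x₁ x₂ y : V) : TSS (bpaSig Act) V Act :=
  {r | BPARule x₁ x₂ y r}

end BPA

end SOS

/-! The only negative premises, in the second sequencing rule, concern a proper subterm of the
source. Hence transitions can be defined by structural recursion on the source (`BPAStep`), and
well-supported provability coincides with truth in this concrete transition system: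
`bpaHolds_of_wsProvable` gives one direction and `wsProvable_of_bpaHolds` the other. By
`sat_bpaSeq_iff`, satisfaction then becomes satisfaction in `BPAStep`, and no proof trees remain.

For the format, all arguments are declared liquid, so that only the counting of propagated and
polled occurrences in the five rules is left.

The precongruence results are not derived from the format but proved by modal decomposition. If `p₁
+ p₂` or `p₁ ; p₂` satisfies an observation, there are observations of the same class for the two
arguments which hold for `p₁`, `p₂` and force the original observation for any arguments satisfying
them (`Decomposable`). For sequencing one must express both that the first argument is stuck (all
actions refused) and that it is not (some `c⊤` holds next to the refusals). Readiness observations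
can do both, as can the two finer classes. Failure observations cannot combine refusals with `c⊤`.

This gap gives the counterexample. For `a ≠ b`, the term `a + a;b` is below `a + a;(a+b)` in the
failure preorder, because after `a` every refusal is already witnessed by `0`. Placed before `;a`,
the stuck `0` passes control to `a`. Now only the left term can do `a` and then refuse `a`. -/

namespace SOS

/-! ### Syntax of terms over the signature -/

section Semantics

variable {Act V : Type u}

/-- This replaces the argument families of `Term.app` by the named constructors, so that later
inductions can use the simp lemmas about `alt` and `seq`. -/
theorem Term.bpa_induction {motive : Term (bpaSig Act) V → Prop}
    (var : ∀ x, motive (.var x)) (atom : ∀ v, motive (SOS.atom v)) (zero : motive SOS.zero)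
    (alt : ∀ s t, motive s → motive t → motive (SOS.alt s t))
    (seq : ∀ s t, motive s → motive t → motive (SOS.seq s t)) (t : Term (bpaSig Act) V) :
    motive t := by
  induction t with
  | var x => exact var x
  | app f ts ih =>
    cases f with
    | atom v =>
      have : ts = (Fin.elim0 : Fin 0 → _) := funext fun i => Fin.elim0 i
      rw [this]; exact atom v
    | zero =>
      have : ts = (Fin.elim0 : Fin 0 → _) := funext fun i => Fin.elim0 i
      rw [this]; exact zero
    | alt =>
      have : ts = (![ts (0 : Fin 2), ts (1 : Fin 2)] : Fin 2 → _) :=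
        funext fun i : Fin 2 => by fin_cases i <;> rfl
      rw [this]; exact alt _ _ (ih (0 : Fin 2)) (ih (1 : Fin 2))
    | seq =>
      have : ts = (![ts (0 : Fin 2), ts (1 : Fin 2)] : Fin 2 → _) :=
        funext fun i : Fin 2 => by fin_cases i <;> rfl
      rw [this]; exact seq _ _ (ih (0 : Fin 2)) (ih (1 : Fin 2))

@[simp] theorem atom_subst (σ : V → Term (bpaSig Act) V) (v : Act) :
    (atom v : Term (bpaSig Act) V).subst σ = atom v := by
  simp only [atom, Term.subst]; congr 1; exact funext fun i => Fin.elim0 i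

@[simp] theorem zero_subst (σ : V → Term (bpaSig Act) V) :
    (zero : Term (bpaSig Act) V).subst σ = zero := by
  simp only [zero, Term.subst]; congr 1; exact funext fun i => Fin.elim0 i

@[simp] theorem alt_subst (σ : V → Term (bpaSig Act) V) (s t : Term (bpaSig Act) V) :
    (alt s t).subst σ = alt (s.subst σ) (t.subst σ) := by
  simp only [alt, Term.subst]; congr 1
  exact funext fun i : Fin 2 => by fin_cases i <;> rfl

@[simp] theorem seq_subst (σ : V → Term (bpaSig Act) V) (s t : Term (bpaSig Act) V) :
    (seq s t).subst σ = seq (s.subst σ) (t.subst σ) := by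
  simp only [seq, Term.subst]; congr 1
  exact funext fun i : Fin 2 => by fin_cases i <;> rfl

@[simp] theorem vars_atom (v : Act) : (atom v : Term (bpaSig Act) V).vars = ∅ :=
  Set.iUnion_eq_empty.2 fun i => Fin.elim0 i

@[simp] theorem vars_zero : (zero : Term (bpaSig Act) V).vars = ∅ :=
  Set.iUnion_eq_empty.2 fun i => Fin.elim0 i

@[simp] theorem vars_alt (s t : Term (bpaSig Act) V) : (alt s t).vars = s.vars ∪ t.vars := by
  ext x
  simp only [alt, Term.vars, Set.mem_iUnion, Set.mem_union]
  exact Fin.exists_fin_two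

@[simp] theorem vars_seq (s t : Term (bpaSig Act) V) : (seq s t).vars = s.vars ∪ t.vars := by
  ext x
  simp only [seq, Term.vars, Set.mem_iUnion, Set.mem_union]
  exact Fin.exists_fin_two

theorem closed_atom (v : Act) : (atom v : Term (bpaSig Act) V).Closed := vars_atom v

theorem closed_zero : (zero : Term (bpaSig Act) V).Closed := vars_zero

theorem closed_alt {s t : Term (bpaSig Act) V} : (alt s t).Closed ↔ s.Closed ∧ t.Closed := by
  simp [Term.Closed]

theorem closed_seq {s t : Term (bpaSig Act) V} : (seq s t).Closed ↔ s.Closed ∧ t.Closed := by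
  simp [Term.Closed]

/-- The number of function symbols in a term. -/
def Term.size {S : Signature.{u}} : Term S V → ℕ
  | var _ => 0
  | app _ ts => 1 + ∑ i, (ts i).size

@[simp] theorem size_alt (s t : Term (bpaSig Act) V) : (alt s t).size = 1 + (s.size + t.size) :=
  congrArg (1 + ·) (Fin.sum_univ_two _)

@[simp] theorem size_seq (s t : Term (bpaSig Act) V) : (seq s t).size = 1 + (s.size + t.size) :=
  congrArg (1 + ·) (Fin.sum_univ_two _)

/-! ### The concrete transition relation and its agreement with ws-provability -/

/-- The transition relation of basic process algebra with sequencing, by recursion on the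
source. -/
def BPAStep : Term (bpaSig Act) V → Act → Term (bpaSig Act) V → Prop
  | .var _, _, _ => False
  | .app (.atom v) _, a, t' => a = v ∧ t' = zero
  | .app .zero _, _, _ => False
  | .app .alt ts, a, t' => BPAStep (ts (0 : Fin 2)) a t' ∨ BPAStep (ts (1 : Fin 2)) a t'
  | .app .seq ts, a, t' =>
      (∃ s', BPAStep (ts (0 : Fin 2)) a s' ∧ t' = seq s' (ts (1 : Fin 2))) ∨
      ((∀ b s', ¬ BPAStep (ts (0 : Fin 2)) b s') ∧ BPAStep (ts (1 : Fin 2)) a t')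

@[simp] theorem bpaStep_atom (v a : Act) (t' : Term (bpaSig Act) V) :
    BPAStep (atom v) a t' ↔ a = v ∧ t' = zero := Iff.rfl

@[simp] theorem bpaStep_alt (s t : Term (bpaSig Act) V) (a : Act) (t' : Term (bpaSig Act) V) :
    BPAStep (alt s t) a t' ↔ BPAStep s a t' ∨ BPAStep t a t' := Iff.rfl

@[simp] theorem bpaStep_seq (s t : Term (bpaSig Act) V) (a : Act) (t' : Term (bpaSig Act) V) :
    BPAStep (seq s t) a t' ↔ (∃ s', BPAStep s a s' ∧ t' = seq s' t) ∨
      ((∀ b s', ¬ BPAStep s b s') ∧ BPAStep t a t') := Iff.rfl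

theorem BPAStep.closed {t : Term (bpaSig Act) V} :
    ∀ {a : Act} {t' : Term (bpaSig Act) V}, t.Closed → BPAStep t a t' → t'.Closed := by
  induction t using Term.bpa_induction with
  | var x => intro a t' _ h; exact h.elim
  | atom v => rintro a t' - ⟨-, rfl⟩; exact closed_zero
  | zero => intro a t' _ h; exact h.elim
  | alt s t ihs iht =>
    intro a t' hc h
    rw [closed_alt] at hc
    exact h.elim (ihs hc.1) (iht hc.2)
  | seq s t ihs iht =>
    intro a t' hc h
    rw [closed_seq] at hc
    rcases h with ⟨s', hs', rfl⟩ | ⟨-, h⟩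
    · exact closed_seq.2 ⟨ihs hc.1 hs', hc.2⟩
    · exact iht hc.2 h

/-- The truth of a literal in the transition system `BPAStep`. -/
def BPAHolds : Literal (bpaSig Act) V Act → Prop
  | .pos t a t' => BPAStep t a t'
  | .neg t a => ∀ t', ¬ BPAStep t a t'

variable {x₁ x₂ y : V}

theorem bpaHolds_of_rule {r : Rule (bpaSig Act) V Act} (hr : r ∈ bpaSeq Act x₁ x₂ y)
    (σ : V → Term (bpaSig Act) V) (h : ∀ β ∈ r.premises, BPAHolds (β.subst σ)) :
    BPAHolds (r.conclusion.subst σ) := by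
  cases hr with
  | atom v => simp [Literal.subst, BPAHolds]
  | alt_left v =>
    have := h _ rfl
    simp only [Literal.subst, alt_subst, BPAHolds, bpaStep_alt] at this ⊢
    exact Or.inl this
  | alt_right v =>
    have := h _ rfl
    simp only [Literal.subst, alt_subst, BPAHolds, bpaStep_alt] at this ⊢
    exact Or.inr this
  | seq_left v =>
    have := h _ rfl
    simp only [Literal.subst, seq_subst, BPAHolds, bpaStep_seq] at this ⊢
    exact Or.inl ⟨_, this, rfl⟩
  | seq_right w =>
    have h₁ := h _ (Or.inl rfl)
    have h₂ := fun v => h _ (Or.inr ⟨v, rfl⟩)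
    simp only [Literal.subst, seq_subst, BPAHolds, bpaStep_seq] at h₁ h₂ ⊢
    exact Or.inr ⟨h₂, h₁⟩

/-- A true transition is rebuilt from the rules by induction on its source; negative premises arise
only for stuck proper subterms. The set `Q` is left abstract because the lemma serves both for
ordinary provability from hypotheses and for ws-provability. The size bound makes it usable inside
an induction on size. -/
theorem mem_of_rule_closed (h₁₂ : x₁ ≠ x₂) (h₁ : x₁ ≠ y) (h₂ : x₂ ≠ y)
    {Q : Literal (bpaSig Act) V Act → Prop}
    (hQ : ∀ r ∈ bpaSeq Act x₁ x₂ y, ∀ σ : V → Term (bpaSig Act) V, (∀ x, (σ x).Closed) →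
      (∀ β ∈ r.premises, Q (β.subst σ)) → Q (r.conclusion.subst σ))
    {t : Term (bpaSig Act) V} :
    (∀ s, s.Closed → s.size < t.size → (∀ v s', ¬ BPAStep s v s') → ∀ v, Q (.neg s v)) →
    ∀ {a : Act} {t' : Term (bpaSig Act) V}, t.Closed → BPAStep t a t' → Q (.pos t a t') := by
  classical
  -- Here the distinctness of the three rule variables is needed: their values can be prescribed
  -- independently.
  have key : ∀ s t t' : Term (bpaSig Act) V, s.Closed → t.Closed → t'.Closed →
      ∃ σ : V → Term (bpaSig Act) V, (∀ x, (σ x).Closed) ∧ σ x₁ = s ∧ σ x₂ = t ∧ σ y = t' := by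
    intro s t t' hs ht ht'
    refine ⟨fun z => if z = x₁ then s else if z = x₂ then t else t', fun x => ?_, ?_, ?_, ?_⟩
    · dsimp only; split_ifs <;> assumption
    · simp
    · simp [h₁₂.symm]
    · simp [h₁.symm, h₂.symm]
  induction t using Term.bpa_induction with
  | var x => intro _ a t' _ h; exact h.elim
  | zero => intro _ a t' _ h; exact h.elim
  | atom v =>
    rintro - a t' - ⟨rfl, rfl⟩
    have := hQ _ (BPARule.atom a) (fun _ => zero) (fun _ => closed_zero) (by simp)
    simpa [Literal.subst] using this
  | alt s t ihs iht =>
    intro hneg a t' hc h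
    have hc' := closed_alt.1 hc
    obtain ⟨σ, hσ, e₁, e₂, e₃⟩ := key s t t' hc'.1 hc'.2 (h.closed hc)
    simp only [size_alt] at hneg
    rcases h with h | h
    · have := hQ _ (BPARule.alt_left a) σ hσ (by
        rintro β rfl
        simpa [Literal.subst, Term.subst, e₁, e₃] using
          ihs (fun r hr hlt => hneg r hr (by omega)) hc'.1 h)
      simpa [Literal.subst, Term.subst, e₁, e₂, e₃] using this
    · have := hQ _ (BPARule.alt_right a) σ hσ (by
        rintro β rfl
        simpa [Literal.subst, Term.subst, e₂, e₃] using
          iht (fun r hr hlt => hneg r hr (by omega)) hc'.2 h)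
      simpa [Literal.subst, Term.subst, e₁, e₂, e₃] using this
  | seq s t ihs iht =>
    intro hneg a t' hc h
    have hc' := closed_seq.1 hc
    simp only [size_seq] at hneg
    rcases h with ⟨s', hs', rfl⟩ | ⟨hs, h⟩
    · obtain ⟨σ, hσ, e₁, e₂, e₃⟩ := key s t s' hc'.1 hc'.2 (hs'.closed hc'.1)
      have := hQ _ (BPARule.seq_left a) σ hσ (by
        rintro β rfl
        simpa [Literal.subst, Term.subst, e₁, e₃] using
          ihs (fun r hr hlt => hneg r hr (by omega)) hc'.1 hs')
      simpa [Literal.subst, Term.subst, e₁, e₂, e₃] using this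
    · obtain ⟨σ, hσ, e₁, e₂, e₃⟩ := key s t t' hc'.1 hc'.2 (h.closed hc'.2)
      have := hQ _ (BPARule.seq_right a) σ hσ (by
        rintro β (rfl | ⟨v, rfl⟩)
        · simpa [Literal.subst, Term.subst, e₂, e₃] using
            iht (fun r hr hlt => hneg r hr (by omega)) hc'.2 h
        · simpa [Literal.subst, Term.subst, e₁] using hneg s hc'.1 (by omega) hs v)
      simpa [Literal.subst, Term.subst, e₁, e₂, e₃] using this

/-- Rules preserve truth. For a negative node, if the denied transition existed, it would be
provable from true negative literals; some literal of `K` would then deny a true one, although `K`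
is true by induction. -/
theorem bpaHolds_of_wsProvable (h₁₂ : x₁ ≠ x₂) (h₁ : x₁ ≠ y) (h₂ : x₂ ≠ y)
    {α : Literal (bpaSig Act) V Act} (h : WSProvable (bpaSeq Act x₁ x₂ y) α) : BPAHolds α := by
  induction h with
  | rule r σ hr _ _ ih => exact bpaHolds_of_rule hr σ ih
  | naf t a K ht _ _ hN ih =>
    intro t' hstep
    -- All true closed negative literals.
    let N : Set (Literal (bpaSig Act) V Act) :=
      {ν | ∃ s b, s.Closed ∧ ν = .neg s b ∧ ∀ s', ¬ BPAStep s b s'}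
    obtain ⟨β, hβ, ν, hν, hden⟩ := hN N (.pos t a t')
      (by rintro ν ⟨s, b, hs, rfl, -⟩; exact ⟨hs, s, b, rfl⟩)
      ⟨ht, hstep.closed ht⟩ ⟨t, a, t', Or.inl ⟨rfl, rfl⟩⟩
      (mem_of_rule_closed (Q := Provable (bpaSeq Act x₁ x₂ y) N) h₁₂ h₁ h₂
        (fun r hr σ _ hp => .rule r σ hr hp)
        (fun s hs _ hstuck v => .hyp _ ⟨s, v, hs, rfl, hstuck v⟩) ht hstep)
    obtain ⟨s, b, -, rfl, hs⟩ := hν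
    obtain ⟨r, c, r', ⟨rfl, e⟩ | ⟨-, e⟩⟩ := hden
    · cases e
      exact hs _ (ih _ hβ)
    · cases e

/-- If the literals in `N` are negative, then every provable positive literal holds, or some
literal in `N`, about a smaller term, fails. -/
theorem bpaStep_of_provable {N : Set (Literal (bpaSig Act) V Act)}
    (hN : ∀ ν ∈ N, ν.IsNegative) {α : Literal (bpaSig Act) V Act}
    (h : Provable (bpaSeq Act x₁ x₂ y) N α) :
    (∀ t a, α = .neg t a → α ∈ N) ∧
    ∀ t a t', α = .pos t a t' → BPAStep t a t' ∨
      ∃ s b s', .neg s b ∈ N ∧ BPAStep s b s' ∧ s.size < t.size := by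
  induction h with
  | hyp α hα =>
    refine ⟨fun _ _ _ => hα, ?_⟩
    rintro t a t' rfl
    obtain ⟨_, _, h⟩ := hN _ hα
    cases h
  | rule r σ hr _ ih =>
    cases hr with
    | atom v =>
      refine ⟨by simp [Literal.subst], ?_⟩
      intro t a t' e
      simp only [Literal.subst, atom_subst, zero_subst, Literal.pos.injEq] at e
      obtain ⟨rfl, rfl, rfl⟩ := e
      exact Or.inl ⟨rfl, rfl⟩
    | alt_left v =>
      refine ⟨by simp [Literal.subst], ?_⟩
      intro t a t' e
      simp only [Literal.subst, alt_subst, Literal.pos.injEq] at e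
      obtain ⟨rfl, rfl, rfl⟩ := e
      refine ((ih _ rfl).2 _ _ _ rfl).imp Or.inl ?_
      rintro ⟨s, b, s', hs, hstep, hlt⟩
      exact ⟨s, b, s', hs, hstep, by rw [size_alt]; omega⟩
    | alt_right v =>
      refine ⟨by simp [Literal.subst], ?_⟩
      intro t a t' e
      simp only [Literal.subst, alt_subst, Literal.pos.injEq] at e
      obtain ⟨rfl, rfl, rfl⟩ := e
      refine ((ih _ rfl).2 _ _ _ rfl).imp Or.inr ?_
      rintro ⟨s, b, s', hs, hstep, hlt⟩
      exact ⟨s, b, s', hs, hstep, by rw [size_alt]; omega⟩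
    | seq_left v =>
      refine ⟨by simp [Literal.subst], ?_⟩
      intro t a t' e
      simp only [Literal.subst, seq_subst, Literal.pos.injEq] at e
      obtain ⟨rfl, rfl, rfl⟩ := e
      refine ((ih _ rfl).2 _ _ _ rfl).imp (fun h => Or.inl ⟨_, h, rfl⟩) ?_
      rintro ⟨s, b, s', hs, hstep, hlt⟩
      exact ⟨s, b, s', hs, hstep, by rw [size_seq]; omega⟩
    | seq_right w =>
      refine ⟨by simp [Literal.subst], ?_⟩
      intro t a t' e
      simp only [Literal.subst, seq_subst, Literal.pos.injEq] at e
      obtain ⟨rfl, rfl, rfl⟩ := e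
      -- Rule conclusions are positive, so a provable negative premise is itself a hypothesis. If
      -- the first argument can move after all, one of these hypotheses is the required false one.
      have hneg := fun v => (ih _ (Or.inr ⟨v, rfl⟩)).1 _ _ rfl
      by_cases hs : ∀ b s', ¬ BPAStep ((Term.var x₁).subst σ) b s'
      · refine ((ih _ (Or.inl rfl)).2 _ _ _ rfl).imp (fun h => Or.inr ⟨hs, h⟩) ?_
        rintro ⟨s, b, s', hs, hstep, hlt⟩
        exact ⟨s, b, s', hs, hstep, by rw [size_seq]; omega⟩
      · push Not at hs
        obtain ⟨b, s', hs⟩ := hs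
        exact Or.inr ⟨_, b, s', hneg b, hs, by rw [size_seq]; omega⟩

/-- Both claims go through one induction on size. A transition needs stuckness of smaller terms
only. To refute a transition, note that any proof of it from `N` uses a false literal of `N` about a
smaller term, and the transition denying that literal is ws-provable by induction. -/
theorem wsProvable_of_bpaHolds (h₁₂ : x₁ ≠ x₂) (h₁ : x₁ ≠ y) (h₂ : x₂ ≠ y)
    (t : Term (bpaSig Act) V) (ht : t.Closed) :
    (∀ a t', BPAStep t a t' → WSProvable (bpaSeq Act x₁ x₂ y) (.pos t a t')) ∧
    ∀ a, (∀ t', ¬ BPAStep t a t') → WSProvable (bpaSeq Act x₁ x₂ y) (.neg t a) := by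
  induction hn : t.size using Nat.strong_induction_on generalizing t with
  | _ n ih =>
    subst hn
    refine ⟨fun a t' => mem_of_rule_closed h₁₂ h₁ h₂
      (fun r hr σ hσ hp => .rule r σ hr hσ hp)
      (fun s hs hlt hstuck v => (ih _ hlt s hs rfl).2 v (hstuck v)) ht, fun a hstuck => ?_⟩
    -- `K` is taken as large as possible, so any ws-provable denial of a member of `N` will do.
    refine .naf t a {β | β.Closed ∧ WSProvable (bpaSeq Act x₁ x₂ y) β} ht (fun β h => h.1)
      (fun β h => h.2) ?_
    rintro N γ hN - ⟨t₀, a₀, t', ⟨rfl, h⟩ | ⟨-, h⟩⟩ hprov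
    · cases h
      rcases (bpaStep_of_provable (fun ν hν => (hN ν hν).2) hprov).2 _ _ _ rfl with
        h | ⟨s, b, s', hs, hstep, hlt⟩
      · exact (hstuck _ h).elim
      · have hsc : s.Closed := (hN _ hs).1
        exact ⟨.pos s b s', ⟨⟨hsc, hstep.closed hsc⟩, (ih _ hlt s hsc rfl).1 _ _ hstep⟩,
          _, hs, s, b, s', Or.inl ⟨rfl, rfl⟩⟩
    · cases h

/-! ### Transitions and observations on closed terms -/

/-- The transition relation of basic process algebra with sequencing on closed terms. -/
def BPATr (p : ClosedTerm (bpaSig Act) V) (a : Act) (q : ClosedTerm (bpaSig Act) V) : Prop :=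
  BPAStep p.1 a q.1

/-- The closed term `p` has no outgoing transitions. -/
def BPAStuck (p : ClosedTerm (bpaSig Act) V) : Prop := ∀ a q, ¬ BPATr p a q

/-- Alternative composition of closed terms. -/
def calt (p q : ClosedTerm (bpaSig Act) V) : ClosedTerm (bpaSig Act) V :=
  ⟨alt p.1 q.1, closed_alt.2 ⟨p.2, q.2⟩⟩

/-- Sequencing of closed terms. -/
def cseq (p q : ClosedTerm (bpaSig Act) V) : ClosedTerm (bpaSig Act) V :=
  ⟨seq p.1 q.1, closed_seq.2 ⟨p.2, q.2⟩⟩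

/-- The closed term `0`. -/
def czero : ClosedTerm (bpaSig Act) V := ⟨zero, closed_zero⟩

/-- An atomic action as a closed term. -/
def catom (v : Act) : ClosedTerm (bpaSig Act) V := ⟨atom v, closed_atom v⟩

theorem app_alt (p : Fin 2 → ClosedTerm (bpaSig Act) V) :
    ClosedTerm.app (S := bpaSig Act) BPASymbol.alt p = calt (p 0) (p 1) := by
  refine Subtype.ext (congrArg (Term.app (S := bpaSig Act) BPASymbol.alt) ?_)
  exact funext fun i : Fin 2 => by fin_cases i <;> rfl

theorem app_seq (p : Fin 2 → ClosedTerm (bpaSig Act) V) :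
    ClosedTerm.app (S := bpaSig Act) BPASymbol.seq p = cseq (p 0) (p 1) := by
  refine Subtype.ext (congrArg (Term.app (S := bpaSig Act) BPASymbol.seq) ?_)
  exact funext fun i : Fin 2 => by fin_cases i <;> rfl

@[simp] theorem bpaTr_czero (a : Act) (r : ClosedTerm (bpaSig Act) V) :
    BPATr czero a r ↔ False := Iff.rfl

@[simp] theorem bpaTr_catom (v a : Act) (r : ClosedTerm (bpaSig Act) V) :
    BPATr (catom v) a r ↔ a = v ∧ r = czero :=
  and_congr_right fun _ => (Subtype.ext_iff (a1 := r) (a2 := czero)).symm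

@[simp] theorem bpaTr_calt (p q : ClosedTerm (bpaSig Act) V) (a : Act)
    (r : ClosedTerm (bpaSig Act) V) :
    BPATr (calt p q) a r ↔ BPATr p a r ∨ BPATr q a r := Iff.rfl

theorem bpaStuck_iff (p : ClosedTerm (bpaSig Act) V) :
    BPAStuck p ↔ ∀ b s', ¬ BPAStep p.1 b s' :=
  ⟨fun h b s' hs => h b ⟨s', hs.closed p.2⟩ hs, fun h b s' => h b s'.1⟩

@[simp] theorem bpaTr_cseq (p q : ClosedTerm (bpaSig Act) V) (a : Act)
    (r : ClosedTerm (bpaSig Act) V) :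
    BPATr (cseq p q) a r ↔
      (∃ p', BPATr p a p' ∧ r = cseq p' q) ∨ (BPAStuck p ∧ BPATr q a r) := by
  refine or_congr ⟨?_, ?_⟩ (and_congr (bpaStuck_iff p).symm Iff.rfl)
  · rintro ⟨s', hs, e⟩
    exact ⟨⟨s', hs.closed p.2⟩, hs, Subtype.ext e⟩
  · rintro ⟨p', hp, rfl⟩
    exact ⟨p'.1, hp, rfl⟩

/-- Satisfaction of observations in the transition system `BPATr`. -/
def BPASat : Obs Act → ClosedTerm (bpaSig Act) V → Prop
  | .top, _ => True
  | .act a φ, p => ∃ q, BPATr p a q ∧ BPASat φ q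
  | .refuse a, p => ∀ q, ¬ BPATr p a q
  | .conj _ φ, p => ∀ i, BPASat (φ i) p

/-- The bridge that removes ws-provability from all preorders. -/
theorem sat_bpaSeq_iff (h₁₂ : x₁ ≠ x₂) (h₁ : x₁ ≠ y) (h₂ : x₂ ≠ y) (φ : Obs Act)
    (p : ClosedTerm (bpaSig Act) V) : Sat (bpaSeq Act x₁ x₂ y) φ p ↔ BPASat φ p := by
  induction φ generalizing p with
  | top => exact Iff.rfl
  | act a φ ih =>
    refine exists_congr fun q => and_congr ⟨fun h => ?_, fun h => ?_⟩ (ih q)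
    · exact bpaHolds_of_wsProvable h₁₂ h₁ h₂ h
    · exact (wsProvable_of_bpaHolds h₁₂ h₁ h₂ p.1 p.2).1 a q.1 h
  | refuse a =>
    refine ⟨fun h q => bpaHolds_of_wsProvable h₁₂ h₁ h₂ h q.1, fun h => ?_⟩
    exact (wsProvable_of_bpaHolds h₁₂ h₁ h₂ p.1 p.2).2 a fun t' ht' =>
      h ⟨t', ht'.closed p.2⟩ ht'
  | conj I φ ih => exact forall_congr' fun i => ih i p

end Semantics

/-! ### The readiness format -/

section Format

variable {Act V : Type u}

theorem occursAt_var {S : Signature.{u}} {x z : V} {π : List ℕ} :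
    (Term.var z : Term S V).OccursAt x π ↔ x = z ∧ π = [] := by
  constructor
  · rintro ⟨⟩; exact ⟨rfl, rfl⟩
  · rintro ⟨rfl, rfl⟩; exact .var

theorem occursAt_zero {x : V} {π : List ℕ} :
    (zero : Term (bpaSig Act) V).OccursAt x π ↔ False := by
  refine ⟨fun h => ?_, False.elim⟩
  rcases h with _ | ⟨f, ts, i, π, h⟩
  exact Fin.elim0 i

theorem occursAt_seq {x : V} {s t : Term (bpaSig Act) V} {π : List ℕ} :
    (seq s t).OccursAt x π ↔
      (∃ π', π = 0 :: π' ∧ s.OccursAt x π') ∨ ∃ π', π = 1 :: π' ∧ t.OccursAt x π' := by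
  constructor
  · intro h
    rcases h with _ | ⟨f, ts, i, π, h⟩
    change Fin 2 at i
    fin_cases i
    · exact Or.inl ⟨π, rfl, h⟩
    · exact Or.inr ⟨π, rfl, h⟩
  · rintro (⟨π', rfl, h⟩ | ⟨π', rfl, h⟩)
    · exact .app (S := bpaSig Act) BPASymbol.seq (![s, t] : Fin 2 → _) (0 : Fin 2) π' h
    · exact .app (S := bpaSig Act) BPASymbol.seq (![s, t] : Fin 2 → _) (1 : Fin 2) π' h

theorem Term.OccursAt.liquidAt {S : Signature.{u}} {Λ : (f : S.symbols) → Fin (S.arity f) → Prop}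
    (hΛ : ∀ f i, Λ f i) {x : V} {t : Term S V} {π : List ℕ} (h : t.OccursAt x π) :
    t.LiquidAt Λ x π := by
  induction h with
  | var => exact .var
  | app f ts i π _ ih => exact .app f ts i π (hΛ f i) ih

/-- The description of propagated occurrences without their terms. -/
theorem Rule.PropagatedAt.cases_on_place {S : Signature.{u}} {r : Rule S V Act} {x : V}
    {l : Option (Literal S V Act)} {t : Term S V} {π : List ℕ} (h : r.PropagatedAt x l t π) :
    t.OccursAt x π ∧ ((l = none ∧ r.HasTarget t) ∨
      ∃ β ∈ r.premises, r.RhsInTarget β ∧ l = some β ∧ t = β.lhs) := by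
  cases h with
  | target u π hu ho => exact ⟨ho, Or.inl ⟨rfl, hu⟩⟩
  | premise β π hβ hr ho => exact ⟨ho, Or.inr ⟨β, hβ, hr, rfl, rfl⟩⟩

/-- With every argument liquid, every position is liquid. The remaining conditions are asked of all
variables, floating or not, which the rules at hand satisfy. -/
theorem readinessSafe_of_liquid {S : Signature.{u}}
    {Λ : (f : S.symbols) → Fin (S.arity f) → Prop} (hΛ : ∀ f i, Λ f i) {r : Rule S V Act}
    (hl : r.NoLookahead)
    (hu : ∀ x l t π l' t' π', r.PropagatedAt x l t π → r.PropagatedAt x l' t' π' →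
      l = l' ∧ π = π')
    (hp : ∀ x l t π, r.PropagatedAt x l t π → ¬ r.IsPolled x) : r.ReadinessSafe Λ :=
  ⟨⟨hl, fun x _ => ⟨hu x, fun _ _ _ h => h.cases_on_place.1.liquidAt hΛ⟩⟩,
    fun x _ h => by obtain ⟨⟨l, t, π, h⟩, h'⟩ := h; exact hp x l t π h h'⟩

variable {x₁ x₂ y : V}

/-- Rules with the single premise `z --v--> y` and target `y`. -/
theorem readinessSafe_of_target_var {S : Signature.{u}}
    {Λ : (f : S.symbols) → Fin (S.arity f) → Prop} (hΛ : ∀ f i, Λ f i) {s : Term S V} {z : V}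
    {v w : Act} {N : Set (Literal S V Act)} (hz : z ≠ y)
    (hN : ∀ β ∈ N, ∃ x b, β = .neg (.var x) b ∧ x ≠ z ∧ x ≠ y) :
    (⟨insert (.pos (.var z) v (.var y)) N, .pos s w (.var y)⟩ : Rule S V Act).ReadinessSafe Λ := by
  set r : Rule S V Act := ⟨insert (.pos (.var z) v (.var y)) N, .pos s w (.var y)⟩ with hr
  have htarget : ∀ u, r.HasTarget u → u = .var y := by
    rintro u ⟨_, _, h⟩; cases h; rfl
  have hprop : ∀ x l t π, r.PropagatedAt x l t π → π = [] ∧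
      ((x = y ∧ l = none) ∨ (x = z ∧ l = some (.pos (.var z) v (.var y)))) := by
    intro x l t π h
    obtain ⟨ho, ⟨rfl, hu⟩ | ⟨β, hβ, hβr, rfl, rfl⟩⟩ := h.cases_on_place
    · rw [htarget _ hu, occursAt_var] at ho
      exact ⟨ho.2, Or.inl ⟨ho.1, rfl⟩⟩
    · rcases hβ with rfl | hβ
      · rw [Literal.lhs, occursAt_var] at ho
        exact ⟨ho.2, Or.inr ⟨ho.1, rfl⟩⟩
      · obtain ⟨x, b, rfl, -⟩ := hN β hβ
        obtain ⟨_, _, _, _, e, -⟩ := hβr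
        cases e
  refine readinessSafe_of_liquid hΛ ?_ ?_ ?_
  · rintro t a t' (h | h) x hx β hβ hxβ
    · cases h
      cases hx
      rcases hβ with rfl | hβ
      · exact hz hxβ.symm
      · obtain ⟨x', b, rfl, -, h⟩ := hN β hβ
        exact h hxβ.symm
    · obtain ⟨x', b, e, -⟩ := hN _ h
      cases e
  · intro x l t π l' t' π' hl hl'
    obtain ⟨rfl, h⟩ := hprop _ _ _ _ hl
    obtain ⟨rfl, h'⟩ := hprop _ _ _ _ hl'
    clear hl hl'
    refine ⟨?_, rfl⟩
    rcases h with ⟨rfl, rfl⟩ | ⟨rfl, rfl⟩ <;> rcases h' with ⟨h, rfl⟩ | ⟨h, rfl⟩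
    · rfl
    · exact (hz h.symm).elim
    · exact (hz h).elim
    · rfl
  · rintro x l t π h ⟨β, hβ, hβr, π', ho⟩
    rcases hβ with rfl | hβ
    · exact hβr ⟨_, _, y, .var y, rfl, ⟨_, _, rfl⟩, rfl⟩
    · obtain ⟨x', b, rfl, h₁, h₂⟩ := hN β hβ
      obtain ⟨rfl, -⟩ := occursAt_var.1 ho
      rcases (hprop _ _ _ _ h).2 with ⟨h, -⟩ | ⟨h, -⟩
      · exact h₂ h
      · exact h₁ h

theorem bpaRule_readinessSafe (h₁₂ : x₁ ≠ x₂) (h₁ : x₁ ≠ y) (h₂ : x₂ ≠ y)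
    {r : Rule (bpaSig Act) V Act} (hr : r ∈ bpaSeq Act x₁ x₂ y) :
    r.ReadinessSafe fun _ _ => True := by
  have hΛ : ∀ (f : (bpaSig Act).symbols) (_ : Fin ((bpaSig Act).arity f)), True :=
    fun _ _ => trivial
  cases hr with
  | atom v =>
    have hno : ∀ x l t π, ¬ Rule.PropagatedAt
        (⟨∅, .pos (atom v) v zero⟩ : Rule (bpaSig Act) V Act) x l t π := by
      intro x l t π h
      obtain ⟨ho, ⟨rfl, _, _, hu⟩ | ⟨β, hβ, -⟩⟩ := h.cases_on_place
      · cases hu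
        exact occursAt_zero.1 ho
      · exact hβ
    exact readinessSafe_of_liquid hΛ (fun t a t' h => h.elim)
      (fun x l t π _ _ _ h => (hno x l t π h).elim) (fun x l t π h => (hno x l t π h).elim)
  | alt_left v =>
    simpa using readinessSafe_of_target_var (S := bpaSig Act) (s := alt (.var x₁) (.var x₂))
      (v := v) (w := v) (N := ∅) hΛ h₁ (by simp)
  | alt_right v =>
    simpa using readinessSafe_of_target_var (S := bpaSig Act) (s := alt (.var x₁) (.var x₂))
      (v := v) (w := v) (N := ∅) hΛ h₂ (by simp)
  | seq_right w =>
    refine readinessSafe_of_target_var hΛ h₂ ?_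
    rintro β ⟨v, rfl⟩
    -- In this rule `x₁` is only polled, while `x₂` and `y` are only propagated.
    exact ⟨x₁, v, rfl, h₁₂, h₁⟩
  | seq_left v =>
    have hprop : ∀ x l t π, Rule.PropagatedAt
        (⟨{.pos (.var x₁) v (.var y)},
          .pos (seq (.var x₁) (.var x₂)) v (seq (.var y) (.var x₂))⟩ : Rule (bpaSig Act) V Act)
        x l t π → (x = y ∧ l = none ∧ π = [0]) ∨ (x = x₂ ∧ l = none ∧ π = [1]) ∨
          (x = x₁ ∧ l = some (.pos (.var x₁) v (.var y)) ∧ π = []) := by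
      intro x l t π h
      obtain ⟨ho, ⟨rfl, _, _, hu⟩ | ⟨β, rfl, -, rfl, rfl⟩⟩ := h.cases_on_place
      · cases hu
        rcases occursAt_seq.1 ho with ⟨π', rfl, h'⟩ | ⟨π', rfl, h'⟩ <;>
          obtain ⟨rfl, rfl⟩ := occursAt_var.1 h' <;> simp
      · obtain ⟨rfl, rfl⟩ := occursAt_var.1 ho
        simp
    refine readinessSafe_of_liquid hΛ ?_ ?_ ?_
    · intro t a t' h x hx β hβ hxβ
      cases h; cases hx; cases hβ
      exact h₁ hxβ.symm
    · intro x l t π l' t' π' h h'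
      rcases hprop _ _ _ _ h with ⟨e, rfl, rfl⟩ | ⟨e, rfl, rfl⟩ | ⟨e, rfl, rfl⟩ <;>
      rcases hprop _ _ _ _ h' with ⟨e', rfl, rfl⟩ | ⟨e', rfl, rfl⟩ | ⟨e', rfl, rfl⟩ <;>
      first
        | exact ⟨rfl, rfl⟩
        -- Off the diagonal, two distinct variables among `x₁`, `x₂`, `y` would coincide.
        | (exfalso; subst e; simp_all)
    · rintro x l t π - ⟨β, rfl, hβr, -⟩
      -- The right-hand side `y` of the only premise occurs in the target, so nothing is polled.
      exact hβr ⟨_, _, y, _, rfl, ⟨_, _, rfl⟩, by simp [Term.vars]⟩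

theorem isNtyft_binary {f : BPASymbol Act} (hf : (bpaSig Act).arity f = 2)
    (h₁₂ : x₁ ≠ x₂) {r : Rule (bpaSig Act) V Act} (hn : r.IsNtytt)
    (hs : r.source = .app f (fun i => .var ((![x₁, x₂] : Fin 2 → V) (Fin.cast hf i)))) :
    r.IsNtyft := by
  refine ⟨hn, f, _, Function.Injective.comp (g := (![x₁, x₂] : Fin 2 → V)) ?_
    (Fin.cast_injective hf), hs⟩
  intro i j hij
  fin_cases i <;> fin_cases j <;> simp_all

theorem isNtytt_of_unique {S : Signature.{u}} {r : Rule S V Act} {z : V} {v : Act}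
    (hy : y ∉ r.source.vars)
    (h : ∀ t a t', Literal.pos t a t' ∈ r.premises → t = .var z ∧ a = v ∧ t' = .var y) :
    r.IsNtytt := by
  refine ⟨fun t a t' ht => ⟨y, (h _ _ _ ht).2.2, hy⟩, fun t a t' a' _ ht ht' => ?_⟩
  obtain ⟨rfl, rfl, -⟩ := h _ _ _ ht
  obtain ⟨rfl, rfl, -⟩ := h _ _ _ ht'
  exact ⟨rfl, rfl⟩

theorem bpaRule_isNtyft (h₁₂ : x₁ ≠ x₂) (h₁ : x₁ ≠ y) (h₂ : x₂ ≠ y)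
    {r : Rule (bpaSig Act) V Act} (hr : r ∈ bpaSeq Act x₁ x₂ y) : r.IsNtyft := by
  have halt : (alt (.var x₁) (.var x₂) : Term (bpaSig Act) V) = .app BPASymbol.alt
      (fun i => .var ((![x₁, x₂] : Fin 2 → V) (Fin.cast rfl i))) :=
    congrArg (Term.app (S := bpaSig Act) BPASymbol.alt)
      (funext fun i : Fin 2 => by fin_cases i <;> rfl)
  have hseq : (seq (.var x₁) (.var x₂) : Term (bpaSig Act) V) = .app BPASymbol.seq
      (fun i => .var ((![x₁, x₂] : Fin 2 → V) (Fin.cast rfl i))) :=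
    congrArg (Term.app (S := bpaSig Act) BPASymbol.seq)
      (funext fun i : Fin 2 => by fin_cases i <;> rfl)
  cases hr with
  | atom v =>
    refine ⟨⟨fun _ _ _ h => h.elim, fun _ _ _ _ _ h => h.elim⟩, BPASymbol.atom v,
      (Fin.elim0 : Fin 0 → V), fun i => Fin.elim0 i, ?_⟩
    exact congrArg (Term.app (S := bpaSig Act) (BPASymbol.atom v))
      (funext fun i => Fin.elim0 i)
  | alt_left v =>
    refine isNtyft_binary rfl h₁₂ (isNtytt_of_unique (y := y) (z := x₁) (v := v) ?_ ?_) halt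
    · simp [Rule.source, Literal.lhs, Term.vars, h₁.symm, h₂.symm]
    · rintro t a t' ⟨⟩; exact ⟨rfl, rfl, rfl⟩
  | alt_right v =>
    refine isNtyft_binary rfl h₁₂ (isNtytt_of_unique (y := y) (z := x₂) (v := v) ?_ ?_) halt
    · simp [Rule.source, Literal.lhs, Term.vars, h₁.symm, h₂.symm]
    · rintro t a t' ⟨⟩; exact ⟨rfl, rfl, rfl⟩
  | seq_left v =>
    refine isNtyft_binary rfl h₁₂ (isNtytt_of_unique (y := y) (z := x₁) (v := v) ?_ ?_) hseq
    · simp [Rule.source, Literal.lhs, Term.vars, h₁.symm, h₂.symm]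
    · rintro t a t' ⟨⟩; exact ⟨rfl, rfl, rfl⟩
  | seq_right w =>
    refine isNtyft_binary rfl h₁₂ (isNtytt_of_unique (y := y) (z := x₂) (v := w) ?_ ?_) hseq
    · simp [Rule.source, Literal.lhs, Term.vars, h₁.symm, h₂.symm]
    · rintro t a t' (h | ⟨v, h⟩)
      · cases h; exact ⟨rfl, rfl, rfl⟩
      · cases h

theorem bpaSeq_inReadinessFormat (h₁₂ : x₁ ≠ x₂) (h₁ : x₁ ≠ y) (h₂ : x₂ ≠ y) :
    InReadinessFormat (bpaSeq Act x₁ x₂ y) := by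
  refine ⟨fun r hr => ?_, fun r hr => Or.inl (bpaRule_isNtyft h₁₂ h₁ h₂ hr),
    fun _ _ => True, fun r hr => bpaRule_readinessSafe h₁₂ h₁ h₂ hr⟩
  cases hr <;> exact ⟨_, _, _, rfl⟩

end Format

/-! ### Modal decomposition and precongruence -/

section Decomposition

variable {Act V : Type u}

/-- The observations in `C` of `op p₁ p₂` follow from observations in `C` of `p₁` and `p₂`. -/
def Decomposable (C : Obs Act → Prop)
    (op : ClosedTerm (bpaSig Act) V → ClosedTerm (bpaSig Act) V → ClosedTerm (bpaSig Act) V) :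
    Prop :=
  ∀ φ, C φ → ∀ p₁ p₂, BPASat φ (op p₁ p₂) → ∃ φ₁ φ₂, C φ₁ ∧ C φ₂ ∧ BPASat φ₁ p₁ ∧
    BPASat φ₂ p₂ ∧ ∀ q₁ q₂, BPASat φ₁ q₁ → BPASat φ₂ q₂ → BPASat φ (op q₁ q₂)

theorem isPrecongruence_of_decomposable {C : Obs Act → Prop}
    (halt : Decomposable (V := V) C calt) (hseq : Decomposable (V := V) C cseq) :
    IsPrecongruence fun p q : ClosedTerm (bpaSig Act) V =>
      ∀ φ, C φ → BPASat φ p → BPASat φ q := by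
  intro f p q hpq φ hφ h
  cases f with
  | atom v => exact (funext fun i => Fin.elim0 i : p = q) ▸ h
  | zero => exact (funext fun i => Fin.elim0 i : p = q) ▸ h
  | alt =>
    rw [app_alt] at h ⊢
    obtain ⟨φ₁, φ₂, c₁, c₂, h₁, h₂, H⟩ := halt φ hφ _ _ h
    exact H _ _ (hpq (0 : Fin 2) _ c₁ h₁) (hpq (1 : Fin 2) _ c₂ h₂)
  | seq =>
    rw [app_seq] at h ⊢
    obtain ⟨φ₁, φ₂, c₁, c₂, h₁, h₂, H⟩ := hseq φ hφ _ _ h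
    exact H _ _ (hpq (0 : Fin 2) _ c₁ h₁) (hpq (1 : Fin 2) _ c₂ h₂)

@[simp] theorem bpaSat_and (φ ψ : Obs Act) (p : ClosedTerm (bpaSig Act) V) :
    BPASat (φ.and ψ) p ↔ BPASat φ p ∧ BPASat ψ p :=
  ⟨fun h => ⟨h ⟨true⟩, h ⟨false⟩⟩, fun h i => by
    obtain ⟨_ | _⟩ := i
    · exact h.2
    · exact h.1⟩

/-- The observation `⋀ᵢ ãᵢ ∧ ⋀ⱼ bⱼ⊤`. -/
abbrev readyObs {A I J : Type u} (a : I → A) (b : J → A) : Obs A :=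
  .and (.conj I fun i => .refuse (a i)) (.conj J fun j => .act (b j) .top)

theorem bpaSat_readyObs {I J : Type u} {a : I → Act} {b : J → Act}
    {p : ClosedTerm (bpaSig Act) V} :
    BPASat (readyObs a b) p ↔ (∀ i q, ¬ BPATr p (a i) q) ∧ ∀ j, ∃ q, BPATr p (b j) q := by
  rw [readyObs, bpaSat_and]
  simp [BPASat]

/-- The observation that all actions are refused. -/
abbrev stuckObs (Act : Type u) : Obs Act := readyObs (fun v : Act => v) (PEmpty.elim : PEmpty → Act)

theorem bpaSat_stuckObs {p : ClosedTerm (bpaSig Act) V} :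
    BPASat (stuckObs Act) p ↔ BPAStuck p := by
  rw [bpaSat_readyObs]
  exact and_iff_left fun j => j.elim

/-- A sum refuses what both summands refuse, so the refusals are copied. Each offered action is
charged to the summands of `calt p₁ p₂` that offer it. -/
theorem readyObs_calt {I J : Type u} {a : I → Act} {b : J → Act}
    {p₁ p₂ : ClosedTerm (bpaSig Act) V} (h : BPASat (readyObs a b) (calt p₁ p₂)) :
    ∃ (J₁ J₂ : Type u) (b₁ : J₁ → Act) (b₂ : J₂ → Act), BPASat (readyObs a b₁) p₁ ∧
      BPASat (readyObs a b₂) p₂ ∧ ∀ q₁ q₂ : ClosedTerm (bpaSig Act) V,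
        BPASat (readyObs a b₁) q₁ → BPASat (readyObs a b₂) q₂ →
          BPASat (readyObs a b) (calt q₁ q₂) := by
  refine ⟨{j // ∃ q, BPATr p₁ (b j) q}, {j // ∃ q, BPATr p₂ (b j) q}, fun j => b j,
    fun j => b j, ?_⟩
  simp only [bpaSat_readyObs, bpaTr_calt] at h ⊢
  refine ⟨⟨fun i q hq => h.1 i q (Or.inl hq), fun j => j.2⟩,
    ⟨fun i q hq => h.1 i q (Or.inr hq), fun j => j.2⟩, ?_⟩
  rintro q₁ q₂ ⟨hr₁, ha₁⟩ ⟨hr₂, ha₂⟩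
  refine ⟨fun i q hq => hq.elim (hr₁ i q) (hr₂ i q), fun j => ?_⟩
  obtain ⟨q, hq | hq⟩ := h.2 j
  · exact (ha₁ ⟨j, q, hq⟩).imp fun _ => Or.inl
  · exact (ha₂ ⟨j, q, hq⟩).imp fun _ => Or.inr

/-- The initial actions of `p₁ ; p₂` are those of `p₂` if `p₁` is stuck and those of `p₁` otherwise.
The observation goes to the relevant argument, and the observation of the first argument must also
record which case applies. -/
theorem readyObs_cseq {I J : Type u} {a : I → Act} {b : J → Act}
    {p₁ p₂ : ClosedTerm (bpaSig Act) V} (h : BPASat (readyObs a b) (cseq p₁ p₂)) :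
    ∃ (I₁ J₁ I₂ J₂ : Type u) (a₁ : I₁ → Act) (b₁ : J₁ → Act) (a₂ : I₂ → Act) (b₂ : J₂ → Act),
      BPASat (readyObs a₁ b₁) p₁ ∧ BPASat (readyObs a₂ b₂) p₂ ∧
      ∀ q₁ q₂ : ClosedTerm (bpaSig Act) V, BPASat (readyObs a₁ b₁) q₁ →
        BPASat (readyObs a₂ b₂) q₂ → BPASat (readyObs a b) (cseq q₁ q₂) := by
  rw [bpaSat_readyObs] at h
  by_cases hp : BPAStuck p₁
  · refine ⟨_, _, I, J, _, _, a, b, bpaSat_stuckObs.2 hp, bpaSat_readyObs.2 ⟨fun i q hq => ?_,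
      fun j => ?_⟩, ?_⟩
    · exact h.1 i q ((bpaTr_cseq _ _ _ _).2 (Or.inr ⟨hp, hq⟩))
    · obtain ⟨q, hq⟩ := h.2 j
      rcases (bpaTr_cseq _ _ _ _).1 hq with ⟨p', hp', -⟩ | ⟨-, hq⟩
      · exact (hp _ _ hp').elim
      · exact ⟨q, hq⟩
    · intro q₁ q₂ h₁ h₂
      rw [bpaSat_stuckObs] at h₁
      rw [bpaSat_readyObs] at h₂ ⊢
      refine ⟨fun i q hq => ?_, fun j => ?_⟩
      · rcases (bpaTr_cseq _ _ _ _).1 hq with ⟨p', hp', -⟩ | ⟨-, hq⟩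
        · exact h₁ _ _ hp'
        · exact h₂.1 i q hq
      · obtain ⟨q, hq⟩ := h₂.2 j
        exact ⟨q, (bpaTr_cseq _ _ _ _).2 (Or.inr ⟨h₁, hq⟩)⟩
  · have hp' : ∃ c p', BPATr p₁ c p' := by
      simpa only [BPAStuck, not_forall, not_not] using hp
    obtain ⟨c, p', hc⟩ := hp'
    -- The extra index `none` demands the action `c` and thereby certifies that `q₁` is not stuck,
    -- so `q₂` cannot contribute initial actions. Nothing is required of `q₂`.
    refine ⟨I, Option J, PEmpty, PEmpty, a, fun j => j.elim c b, PEmpty.elim, PEmpty.elim,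
      bpaSat_readyObs.2 ⟨fun i q hq => ?_, ?_⟩, bpaSat_readyObs.2 ⟨fun i => i.elim, fun j => j.elim⟩, ?_⟩
    · exact h.1 i _ ((bpaTr_cseq _ _ _ _).2 (Or.inl ⟨q, hq, rfl⟩))
    · rintro (_ | j)
      · exact ⟨p', hc⟩
      · obtain ⟨q, hq⟩ := h.2 j
        rcases (bpaTr_cseq _ _ _ _).1 hq with ⟨p', hp', -⟩ | ⟨hs, -⟩
        · exact ⟨p', hp'⟩
        · exact (hp hs).elim
    · intro q₁ q₂ h₁ _
      rw [bpaSat_readyObs] at h₁ ⊢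
      refine ⟨fun i q hq => ?_, fun j => ?_⟩
      · rcases (bpaTr_cseq _ _ _ _).1 hq with ⟨p', hp', -⟩ | ⟨hs, -⟩
        · exact h₁.1 i _ hp'
        · obtain ⟨q', hq'⟩ := h₁.2 none
          exact hs _ _ hq'
      · obtain ⟨q, hq⟩ := h₁.2 (some j)
        exact ⟨_, (bpaTr_cseq _ _ _ _).2 (Or.inl ⟨q, hq, rfl⟩)⟩

theorem act_calt {C : Obs Act → Prop} (htop : C .top) {a : Act} {φ : Obs Act}
    (hφ : C (.act a φ)) (p₁ p₂ : ClosedTerm (bpaSig Act) V)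
    (h : BPASat (.act a φ) (calt p₁ p₂)) :
    ∃ φ₁ φ₂, C φ₁ ∧ C φ₂ ∧ BPASat φ₁ p₁ ∧ BPASat φ₂ p₂ ∧
      ∀ q₁ q₂ : ClosedTerm (bpaSig Act) V, BPASat φ₁ q₁ → BPASat φ₂ q₂ →
        BPASat (.act a φ) (calt q₁ q₂) := by
  obtain ⟨r, hr | hr, hs⟩ := h
  · exact ⟨_, .top, hφ, htop, ⟨r, hr, hs⟩, trivial, fun q₁ q₂ h _ =>
      h.imp fun _ h => ⟨Or.inl h.1, h.2⟩⟩
  · exact ⟨.top, _, htop, hφ, trivial, ⟨r, hr, hs⟩, fun q₁ q₂ _ h =>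
      h.imp fun _ h => ⟨Or.inr h.1, h.2⟩⟩

/-- Either the first argument moves and the decomposition of the residual is prefixed by `a`, or it
is stuck and the whole observation passes to the second argument. The stuckness observation `σ` is a
parameter because its syntactic form depends on the class `C`. -/
theorem act_cseq {C : Obs Act → Prop} (hact : ∀ a φ, C φ → C (.act a φ)) {σ : Obs Act}
    (hσ : C σ) (hstuck : ∀ p : ClosedTerm (bpaSig Act) V, BPASat σ p ↔ BPAStuck p)
    {a : Act} {φ : Obs Act} (hφ : C φ)
    (ih : ∀ p₁ p₂ : ClosedTerm (bpaSig Act) V, BPASat φ (cseq p₁ p₂) →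
      ∃ φ₁ φ₂, C φ₁ ∧ C φ₂ ∧ BPASat φ₁ p₁ ∧ BPASat φ₂ p₂ ∧
        ∀ q₁ q₂ : ClosedTerm (bpaSig Act) V, BPASat φ₁ q₁ → BPASat φ₂ q₂ →
          BPASat φ (cseq q₁ q₂))
    (p₁ p₂ : ClosedTerm (bpaSig Act) V) (h : BPASat (.act a φ) (cseq p₁ p₂)) :
    ∃ φ₁ φ₂, C φ₁ ∧ C φ₂ ∧ BPASat φ₁ p₁ ∧ BPASat φ₂ p₂ ∧
      ∀ q₁ q₂ : ClosedTerm (bpaSig Act) V, BPASat φ₁ q₁ → BPASat φ₂ q₂ →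
        BPASat (.act a φ) (cseq q₁ q₂) := by
  obtain ⟨r, hr, hs⟩ := h
  rcases (bpaTr_cseq _ _ _ _).1 hr with ⟨p', hp', rfl⟩ | ⟨hst, hr⟩
  · obtain ⟨φ₁, φ₂, c₁, c₂, h₁, h₂, H⟩ := ih _ _ hs
    refine ⟨.act a φ₁, φ₂, hact _ _ c₁, c₂, ⟨p', hp', h₁⟩, h₂, ?_⟩
    rintro q₁ q₂ ⟨q', hq', hs'⟩ hq₂
    exact ⟨_, (bpaTr_cseq _ _ _ _).2 (Or.inl ⟨q', hq', rfl⟩), H _ _ hs' hq₂⟩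
  · refine ⟨σ, .act a φ, hσ, hact _ _ hφ, (hstuck _).2 hst, ⟨r, hr, hs⟩, ?_⟩
    rintro q₁ q₂ hq₁ ⟨q', hq', hs'⟩
    exact ⟨_, (bpaTr_cseq _ _ _ _).2 (Or.inr ⟨(hstuck _).1 hq₁, hq'⟩), hs'⟩

theorem decomposable_readySimulation_calt :
    Decomposable (V := V) (fun _ : Obs Act => True) calt := by
  intro φ _
  induction φ with
  | top => exact fun _ _ _ => ⟨.top, .top, trivial, trivial, trivial, trivial, fun _ _ _ _ => trivial⟩
  | act a φ => exact act_calt trivial trivial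
  | refuse a =>
    intro p₁ p₂ h
    exact ⟨.refuse a, .refuse a, trivial, trivial, fun q hq => h q (Or.inl hq),
      fun q hq => h q (Or.inr hq), fun q₁ q₂ h₁ h₂ q hq => hq.elim (h₁ q) (h₂ q)⟩
  | conj I φ ih =>
    intro p₁ p₂ h
    -- The conjuncts are decomposed separately and the results conjoined, which is possible because
    -- this class has arbitrary conjunctions.
    choose φ₁ φ₂ _ _ h₁ h₂ H using fun i => ih i p₁ p₂ (h i)
    exact ⟨.conj I φ₁, .conj I φ₂, trivial, trivial, h₁, h₂,
      fun q₁ q₂ h₁ h₂ i => H i q₁ q₂ (h₁ i) (h₂ i)⟩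

theorem decomposable_readySimulation_cseq :
    Decomposable (V := V) (fun _ : Obs Act => True) cseq := by
  intro φ _
  induction φ with
  | top => exact fun _ _ _ => ⟨.top, .top, trivial, trivial, trivial, trivial, fun _ _ _ _ => trivial⟩
  | act a φ ih =>
    exact act_cseq (fun _ _ _ => trivial) trivial (fun _ => bpaSat_stuckObs) trivial ih
  | refuse a =>
    intro p₁ p₂ h
    -- A single refusal is treated as a ready observation with one refused and no demanded action.
    have h' : BPASat (readyObs (fun _ : PUnit.{u + 1} => a) (PEmpty.elim : PEmpty.{u + 1} → Act))
        (cseq p₁ p₂) := bpaSat_readyObs.2 ⟨fun _ => h, fun j => j.elim⟩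
    obtain ⟨_, _, _, _, _, _, _, _, h₁, h₂, H⟩ := readyObs_cseq h'
    exact ⟨_, _, trivial, trivial, h₁, h₂,
      fun q₁ q₂ h₁ h₂ => (bpaSat_readyObs.1 (H q₁ q₂ h₁ h₂)).1 ⟨⟩⟩
  | conj I φ ih =>
    intro p₁ p₂ h
    choose φ₁ φ₂ _ _ h₁ h₂ H using fun i => ih i p₁ p₂ (h i)
    exact ⟨.conj I φ₁, .conj I φ₂, trivial, trivial, h₁, h₂,
      fun q₁ q₂ h₁ h₂ i => H i q₁ q₂ (h₁ i) (h₂ i)⟩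

theorem decomposable_readyTrace_calt :
    Decomposable (V := V) (IsReadyTraceObs (A := Act)) calt := by
  intro φ hφ
  induction hφ with
  | top => exact fun _ _ _ => ⟨.top, .top, .top, .top, trivial, trivial, fun _ _ _ _ => trivial⟩
  | act a φ hφ => exact act_calt .top (.act _ _ hφ)
  | ready I J a b φ hφ ih =>
    intro p₁ p₂ h
    obtain ⟨h, h'⟩ := (bpaSat_and _ _ _).1 h
    obtain ⟨φ₁, φ₂, c₁, c₂, h₁, h₂, H⟩ := ih _ _ h'
    obtain ⟨_, _, b₁, b₂, r₁, r₂, H'⟩ := readyObs_calt h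
    refine ⟨_, _, .ready _ _ a b₁ _ c₁, .ready _ _ a b₂ _ c₂, (bpaSat_and _ _ _).2 ⟨r₁, h₁⟩,
      (bpaSat_and _ _ _).2 ⟨r₂, h₂⟩, fun q₁ q₂ h₁ h₂ => ?_⟩
    rw [bpaSat_and] at h₁ h₂
    exact (bpaSat_and _ _ _).2 ⟨H' _ _ h₁.1 h₂.1, H _ _ h₁.2 h₂.2⟩

theorem decomposable_readyTrace_cseq :
    Decomposable (V := V) (IsReadyTraceObs (A := Act)) cseq := by
  intro φ hφ
  induction hφ with
  | top => exact fun _ _ _ => ⟨.top, .top, .top, .top, trivial, trivial, fun _ _ _ _ => trivial⟩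
  | act a φ hφ ih =>
    -- Ready trace grammar requires a continuation, so stuckness is expressed with a trailing `⊤`.
    refine act_cseq .act (.ready _ _ (fun v : Act => v) (PEmpty.elim : PEmpty → Act) _ .top) (fun p => ?_) hφ ih
    exact (bpaSat_and _ _ p).trans ((and_iff_left trivial).trans bpaSat_stuckObs)
  | ready I J a b φ hφ ih =>
    intro p₁ p₂ h
    obtain ⟨h, h'⟩ := (bpaSat_and _ _ _).1 h
    obtain ⟨φ₁, φ₂, c₁, c₂, h₁, h₂, H⟩ := ih _ _ h'
    obtain ⟨_, _, _, _, a₁, b₁, a₂, b₂, r₁, r₂, H'⟩ := readyObs_cseq h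
    refine ⟨_, _, .ready _ _ a₁ b₁ _ c₁, .ready _ _ a₂ b₂ _ c₂, (bpaSat_and _ _ _).2 ⟨r₁, h₁⟩,
      (bpaSat_and _ _ _).2 ⟨r₂, h₂⟩, fun q₁ q₂ h₁ h₂ => ?_⟩
    rw [bpaSat_and] at h₁ h₂
    exact (bpaSat_and _ _ _).2 ⟨H' _ _ h₁.1 h₂.1, H _ _ h₁.2 h₂.2⟩

theorem decomposable_readiness_calt :
    Decomposable (V := V) (IsReadinessObs (A := Act)) calt := by
  intro φ hφ
  induction hφ with
  | top => exact fun _ _ _ => ⟨.top, .top, .top, .top, trivial, trivial, fun _ _ _ _ => trivial⟩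
  | act a φ hφ => exact act_calt .top (.act _ _ hφ)
  | ready I J a b =>
    intro p₁ p₂ h
    obtain ⟨_, _, b₁, b₂, r₁, r₂, H⟩ := readyObs_calt h
    exact ⟨_, _, .ready _ _ a b₁, .ready _ _ a b₂, r₁, r₂, H⟩

theorem decomposable_readiness_cseq :
    Decomposable (V := V) (IsReadinessObs (A := Act)) cseq := by
  intro φ hφ
  induction hφ with
  | top => exact fun _ _ _ => ⟨.top, .top, .top, .top, trivial, trivial, fun _ _ _ _ => trivial⟩
  | act a φ hφ ih => exact act_cseq .act (.ready _ _ _ _) (fun _ => bpaSat_stuckObs) hφ ih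
  | ready I J a b =>
    intro p₁ p₂ h
    obtain ⟨_, _, _, _, a₁, b₁, a₂, b₂, r₁, r₂, H⟩ := readyObs_cseq h
    exact ⟨_, _, .ready _ _ a₁ b₁, .ready _ _ a₂ b₂, r₁, r₂, H⟩

end Decomposition

/-! ### Failure of precongruence for the failure preorder -/

section Failure

variable {Act V : Type u}

theorem bpaTr_cseq_czero (p : ClosedTerm (bpaSig Act) V) (a : Act)
    (r : ClosedTerm (bpaSig Act) V) : BPATr (cseq czero p) a r ↔ BPATr p a r := by
  simp [BPAStuck]

theorem bpaTr_cseq_catom (p : ClosedTerm (bpaSig Act) V) (v a : Act)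
    (r : ClosedTerm (bpaSig Act) V) :
    BPATr (cseq (catom v) p) a r ↔ a = v ∧ r = cseq czero p := by
  have : ¬ BPAStuck (catom v : ClosedTerm (bpaSig Act) V) := fun h =>
    h v czero ((bpaTr_catom _ _ _).2 ⟨rfl, rfl⟩)
  simp only [bpaTr_cseq, this, false_and, or_false, bpaTr_catom]
  constructor
  · rintro ⟨p', ⟨rfl, rfl⟩, rfl⟩; exact ⟨rfl, rfl⟩
  · rintro ⟨rfl, rfl⟩; exact ⟨_, ⟨rfl, rfl⟩, rfl⟩

/-- `a + a;b` is below `a + a;(a + b)` in the failure preorder. -/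
theorem failure_alt_seq_atom (a b : Act) {φ : Obs Act} (hφ : IsFailureObs φ)
    (h : BPASat φ (calt (catom a) (cseq (catom a) (catom b)) : ClosedTerm (bpaSig Act) V)) :
    BPASat φ (calt (catom a) (cseq (catom a) (calt (catom a) (catom b))) :
      ClosedTerm (bpaSig Act) V) := by
  cases hφ with
  | top => trivial
  | fail I c =>
    intro i q hq
    have ha : c i = a := by
      rcases (bpaTr_calt _ _ _ _).1 hq with hq | hq
      · exact ((bpaTr_catom _ _ _).1 hq).1
      · exact ((bpaTr_cseq_catom _ _ _ _).1 hq).1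
    exact h i czero (Or.inl ((bpaTr_catom _ _ _).2 ⟨ha, rfl⟩))
  | act c φ hφ =>
    obtain ⟨r, hr, hs⟩ := h
    rcases (bpaTr_calt _ _ _ _).1 hr with hr | hr
    · exact ⟨r, Or.inl hr, hs⟩
    · obtain ⟨rfl, rfl⟩ := (bpaTr_cseq_catom _ _ _ _).1 hr
      cases hφ with
      | top => exact ⟨czero, Or.inl ((bpaTr_catom _ _ _).2 ⟨rfl, rfl⟩), trivial⟩
      | fail I d =>
        -- The summand `a` leads to `0`, which refuses everything, so no refusal after `a` tells the
        -- two terms apart.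
        exact ⟨czero, Or.inl ((bpaTr_catom _ _ _).2 ⟨rfl, rfl⟩), fun _ _ h => h⟩
      | act d ψ _ =>
        obtain ⟨r, hr, hs⟩ := hs
        rw [bpaTr_cseq_czero] at hr
        exact ⟨_, Or.inr ((bpaTr_cseq_catom _ _ _ _).2 ⟨rfl, rfl⟩), r,
          (bpaTr_cseq_czero _ _ _).2 (Or.inr hr), hs⟩

/-- In the context `_ ; a` with the observation "`a`, then refuse `a`", the left term reaches
`(0;b);a`, which offers only `b`. The right term reaches only `0;a` and `(0;(a+b));a`, both of which
offer `a`. -/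
theorem not_isPrecongruence_failure [Nontrivial Act] :
    ¬ IsPrecongruence fun p q : ClosedTerm (bpaSig Act) V =>
      ∀ φ, IsFailureObs φ → BPASat φ p → BPASat φ q := by
  intro hcongr
  obtain ⟨a, b, hab⟩ := exists_pair_ne Act
  have hc := hcongr BPASymbol.seq
    (![calt (catom a) (cseq (catom a) (catom b)), catom a] : Fin 2 → _)
    (![calt (catom a) (cseq (catom a) (calt (catom a) (catom b))), catom a] : Fin 2 → _)
    (fun i : Fin 2 => by
      fin_cases i
      · exact fun φ hφ => failure_alt_seq_atom a b hφ
      · exact fun _ _ => id)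
    (.act a (.conj PUnit fun _ => .refuse a)) (.act _ _ (.fail _ _))
  rw [app_seq, app_seq] at hc
  obtain ⟨r, hr, hs⟩ := hc (by
    refine ⟨cseq (cseq czero (catom b)) (catom a), (bpaTr_cseq _ _ _ _).2 (Or.inl ⟨_,
      Or.inr ((bpaTr_cseq_catom _ _ _ _).2 ⟨rfl, rfl⟩), rfl⟩), fun _ q hq => ?_⟩
    rcases (bpaTr_cseq _ _ _ _).1 hq with ⟨p', hp', -⟩ | ⟨hst, -⟩
    · rw [bpaTr_cseq_czero, bpaTr_catom] at hp'
      exact hab hp'.1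
    -- The residual `0;b` can do `b`, so the trailing `a` is not enabled.
    · exact hst b czero ((bpaTr_cseq_czero _ _ _).2 ((bpaTr_catom _ _ _).2 ⟨rfl, rfl⟩)))
  have hs' : ∀ q, ¬ BPATr r a q := hs ⟨⟩
  rcases (bpaTr_cseq _ _ _ _).1 hr with ⟨p', hp', rfl⟩ | ⟨hst, -⟩
  · rcases hp' with hp' | hp'
    · obtain ⟨-, rfl⟩ := (bpaTr_catom _ _ _).1 hp'
      exact hs' czero ((bpaTr_cseq_czero _ _ _).2 ((bpaTr_catom _ _ _).2 ⟨rfl, rfl⟩))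
    · obtain ⟨-, rfl⟩ := (bpaTr_cseq_catom _ _ _ _).1 hp'
      exact hs' _ ((bpaTr_cseq _ _ _ _).2 (Or.inl ⟨czero, (bpaTr_cseq_czero _ _ _).2
        (Or.inl ((bpaTr_catom _ _ _).2 ⟨rfl, rfl⟩)), rfl⟩))
  · exact hst a czero (Or.inl ((bpaTr_catom _ _ _).2 ⟨rfl, rfl⟩))

end Failure

end SOS

theorem mainTheorem11 {Act V : Type u} (x₁ x₂ y : V)
    (h₁₂ : x₁ ≠ x₂) (h₁ : x₁ ≠ y) (h₂ : x₂ ≠ y) :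
    SOS.InReadinessFormat (SOS.bpaSeq Act x₁ x₂ y) ∧
    SOS.IsPrecongruence (SOS.ReadySimulationPreorder (SOS.bpaSeq Act x₁ x₂ y)) ∧
    SOS.IsPrecongruence (SOS.ReadyTracePreorder (SOS.bpaSeq Act x₁ x₂ y)) ∧
    SOS.IsPrecongruence (SOS.ReadinessPreorder (SOS.bpaSeq Act x₁ x₂ y)) ∧
    (Nontrivial Act → ¬ SOS.IsPrecongruence (SOS.FailurePreorder (SOS.bpaSeq Act x₁ x₂ y))) := by
  have hsat := SOS.sat_bpaSeq_iff (Act := Act) h₁₂ h₁ h₂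
  refine ⟨SOS.bpaSeq_inReadinessFormat h₁₂ h₁ h₂, ?_, ?_, ?_, fun _ => ?_⟩
  · simpa [SOS.IsPrecongruence, SOS.ReadySimulationPreorder, hsat] using
      SOS.isPrecongruence_of_decomposable (Act := Act) (V := V)
        SOS.decomposable_readySimulation_calt SOS.decomposable_readySimulation_cseq
  · simpa only [SOS.IsPrecongruence, SOS.ReadyTracePreorder, hsat] using
      SOS.isPrecongruence_of_decomposable (Act := Act) (V := V)
        SOS.decomposable_readyTrace_calt SOS.decomposable_readyTrace_cseq
  · simpa only [SOS.IsPrecongruence, SOS.ReadinessPreorder, hsat] using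
      SOS.isPrecongruence_of_decomposable (Act := Act) (V := V)
        SOS.decomposable_readiness_calt SOS.decomposable_readiness_cseq
  · simpa only [SOS.IsPrecongruence, SOS.FailurePreorder, hsat] using
      SOS.not_isPrecongruence_failure (Act := Act) (V := V)
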